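/- Let $p,q\ge 0$ with $p+q=1$ and let $\alpha,\beta\ge 0$. For $n\ge 0$ let $\mathcal X_n$ be the set of $n$-element subsets $x=\{x_1<\dots<x_n\}$ of $\mathbb Z^+=\{0,1,2,\dots\}$, and let $\mathcal E_n=\ell^1(\mathcal X_n)$ (complex-valued functions). Closed $n$-particle ASEP is the continuous-time Markov chain on $\mathcal X_n$ in which each particle jumps one step to the right at rate $p$ and, if it is not at $0$, one step to the left at rate $q$, provided that the target site is empty. Let $\mathfrak p_n(x,y;t)$ be the probability that it is in configuration $x$ at time $t$, given that it started in $y$. For $\operatorname{Re} s>0$ let $L_n(s)$ be the bounded operator on $\mathcal E_n$ with kernel $\int_0^\infty e^{-st}\,\mathfrak p_n(x,y;t)\,dt$. Open ASEP is the Markov chain on $\bigcup_n\mathcal X_n$ with the same jumps in which, in addition, a particle is injected at site $0$ at rate $\alpha$ when site $0$ is empty, and a particle at site $0$ is ejected at rate $\beta$. For an arbitrary initial law on the countable set $\bigcup_n\mathcal X_n$, let $P_n(x;t)$ be the probability that open ASEP is in configuration $x\in\mathcal X_n$ at time $t$, let $\hat P_n(x;s)=\int_0^\infty e^{-st}P_n(x;t)\,dt$,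 and set $P(0)=(P_n(\cdot\,;0))_{n\ge0}$, $\hat P(s)=(\hat P_n(\cdot\,;s))_{n\ge0}$. On the $\ell^1$ direct sum $\bigoplus_{n\ge0}\mathcal E_n$ consider the bounded operators $L(s)$, $\delta$, $A$, $B$ given, with $\delta(x_1)=1$ if $0\in x$ and $\delta(x_1)=0$ otherwise (in particular for $n=0$), by $$(L(s)F)_n=L_n(s)F_n,\qquad (\delta F)_n(x)=\delta(x_1)\,F_n(x),$$ $$(AF)_n(x_1,\dots,x_n)=\delta(x_1)\,F_{n-1}(x_2,\dots,x_n),\qquad (AF)_0=0,$$ $$(BF)_n(x_1,\dots,x_n)=(1-\delta(x_1))\,F_{n+1}(0,x_1,\dots,x_n).$$ **Theorem 1.** There is a real number $s_0$, not depending on the initial law, such that for all complex $s$ with $\operatorname{Re} s>\max(s_0,\alpha,0)$ the Laplace integrals of $e^{-st}\,\mathfrak p_n(x,y;t)$ and $e^{-(s-\alpha)t}P_n(x;t)$ converge absolutely, the operator $I-L(s)\big((\alpha-\beta)\delta+\alpha A+\beta B\big)$ is invertible in the bounded operators on $\bigoplus_n\mathcal E_n$, and $$\hat P(s-\alpha)=\Big(I-L(s)\big((\alpha-\beta)\,\delta+\alpha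 A+\beta B\big)\Big)^{-1}L(s)\,P(0).$$ -/

import Mathlib

open scoped NNReal ENNReal

noncomputable section

namespace ASEP

/-! ### Continuous-time Markov chains on a countable state space -/

section Chain

variable {S : Type} [DecidableEq S]

/-- The total rate at which the chain with jump rates `r y z` (from `y` to `z`) leaves `y`. -/
def exitRate (r : S → S → ℝ≥0∞) (y : S) : ℝ := (∑' z, r y z).toReal

/-- The probability that the chain with jump rates `r`, started at `y`, is at `x` at time `t`
after exactly `k` jumps: the chain waits at `y` for an exponential time of parameter
`exitRate r y`, then jumps to `z` with probability `r y z / exitRate r y`, and starts afresh. -/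
def jumpProb (r : S → S → ℝ≥0∞) : ℕ → ℝ → S → S → ℝ≥0∞
  | 0, t, y, x => if y = x then ENNReal.ofReal (Real.exp (-(exitRate r y * t))) else 0
  | k + 1, t, y, x => ∫⁻ u in Set.Ioc 0 t,
      ENNReal.ofReal (Real.exp (-(exitRate r y * u))) * ∑' z, r y z * jumpProb r k (t - u) z x

/-- The probability that the chain with jump rates `r`, started at `y`, is at `x` at time `t`. -/
def transProb (r : S → S → ℝ≥0∞) (t : ℝ) (y x : S) : ℝ≥0∞ := ∑' k, jumpProb r k t y x

theorem tsum_lintegral_le {ι X : Type} [MeasurableSpace X] (μ : MeasureTheory.Measure X)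
    (f : ι → X → ℝ≥0∞) : ∑' i, ∫⁻ a, f i a ∂μ ≤ ∫⁻ a, ∑' i, f i a ∂μ := by
  classical
  rw [ENNReal.tsum_eq_iSup_sum]
  refine iSup_le fun s => ?_
  have h : ∑ i ∈ s, ∫⁻ a, f i a ∂μ ≤ ∫⁻ a, ∑ i ∈ s, f i a ∂μ := by
    induction s using Finset.induction_on with
    | empty => simp
    | insert i s hi ih =>
      simp only [Finset.sum_insert hi]
      exact (add_le_add le_rfl ih).trans (MeasureTheory.le_lintegral_add _ _)
  exact h.trans (MeasureTheory.lintegral_mono fun a => ENNReal.sum_le_tsum s)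

theorem lintegral_exit (c t : ℝ) (hc : 0 ≤ c) (ht : 0 ≤ t) :
    ENNReal.ofReal (Real.exp (-(c * t))) +
      ∫⁻ u in Set.Ioc 0 t, ENNReal.ofReal (Real.exp (-(c * u))) * ENNReal.ofReal c = 1 := by
  have h1 : ∫⁻ u in Set.Ioc 0 t, ENNReal.ofReal (Real.exp (-(c * u))) * ENNReal.ofReal c
      = ENNReal.ofReal (∫ u in Set.Ioc 0 t, Real.exp (-(c * u)) * c) := by
    rw [MeasureTheory.ofReal_integral_eq_lintegral_ofReal]
    · refine MeasureTheory.lintegral_congr fun u => ?_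
      rw [ENNReal.ofReal_mul (Real.exp_pos _).le]
    · exact (Continuous.integrableOn_Icc (by fun_prop)).mono_set Set.Ioc_subset_Icc_self
    · exact Filter.Eventually.of_forall fun u => mul_nonneg (Real.exp_pos _).le hc
  have h2 : ∫ u in Set.Ioc 0 t, Real.exp (-(c * u)) * c = 1 - Real.exp (-(c * t)) := by
    rw [← intervalIntegral.integral_of_le ht]
    have := intervalIntegral.integral_eq_sub_of_hasDerivAt (a := 0) (b := t)
      (f := fun u => -Real.exp (-(c * u))) (f' := fun u => Real.exp (-(c * u)) * c)
      (fun u _ => by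
        have := (((hasDerivAt_id u).const_mul c).neg.exp).neg
        refine (this.congr_deriv ?_).congr_of_eventuallyEq
          (Filter.Eventually.of_forall fun x => ?_)
        · simp
        · simp)
      (Continuous.intervalIntegrable (by fun_prop) _ _)
    rw [this]; simp; ring
  rw [h1, h2, ← ENNReal.ofReal_add (Real.exp_pos _).le]
  · simp
  · have : Real.exp (-(c * t)) ≤ 1 := Real.exp_le_one_iff.2 (by nlinarith)
    linarith

theorem sum_jumpProb_le_one (r : S → S → ℝ≥0∞) (hr : ∀ y, ∑' z, r y z ≠ ∞) (n : ℕ) :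
    ∀ (t : ℝ) (y : S), 0 ≤ t → ∑' x, ∑ k ∈ Finset.range n, jumpProb r k t y x ≤ 1 := by
  induction n with
  | zero => intro t y _; simp
  | succ n ih =>
    intro t y ht
    have hc : 0 ≤ exitRate r y := ENNReal.toReal_nonneg
    have hS : (∑' z, r y z) = ENNReal.ofReal (exitRate r y) := (ENNReal.ofReal_toReal (hr y)).symm
    simp only [Finset.sum_range_succ']
    rw [ENNReal.tsum_add, add_comm]
    rw [← lintegral_exit (exitRate r y) t hc ht]
    refine add_le_add ?_ ?_
    · simp [jumpProb]
    · simp only [jumpProb]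
      refine (ENNReal.tsum_le_tsum fun x => ?_).trans
        ((tsum_lintegral_le (MeasureTheory.volume.restrict (Set.Ioc 0 t)) (fun x u => ENNReal.ofReal (Real.exp (-(exitRate r y * u))) *
          ∑' z, r y z * ∑ k ∈ Finset.range n, jumpProb r k (t - u) z x)).trans ?_)
      · rw [← Finset.tsum_subtype]
        refine (tsum_lintegral_le _ _).trans (MeasureTheory.lintegral_mono fun u => ?_)
        simp only []
        rw [ENNReal.tsum_mul_left, ENNReal.tsum_comm]
        refine mul_le_mul le_rfl (ENNReal.tsum_le_tsum fun z => ?_) bot_le bot_le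
        rw [ENNReal.tsum_mul_left]
        refine mul_le_mul le_rfl (le_of_eq ?_) bot_le bot_le
        exact Finset.tsum_subtype (Finset.range n) (fun k => jumpProb r k (t - u) z x)
      · refine MeasureTheory.setLIntegral_mono' measurableSet_Ioc fun u hu => ?_
        rw [ENNReal.tsum_mul_left, ENNReal.tsum_comm, ← hS]
        refine mul_le_mul le_rfl (ENNReal.tsum_le_tsum fun z => ?_) bot_le bot_le
        rw [ENNReal.tsum_mul_left]
        exact (mul_le_mul le_rfl (ih (t - u) z (sub_nonneg.2 hu.2)) bot_le bot_le).trans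
          (mul_one _).le

theorem tsum_transProb_le_one (r : S → S → ℝ≥0∞) (hr : ∀ y, ∑' z, r y z ≠ ∞) (t : ℝ) (ht : 0 ≤ t)
    (y : S) : ∑' x, transProb r t y x ≤ 1 := by
  unfold transProb
  rw [ENNReal.tsum_comm, ENNReal.tsum_eq_iSup_nat]
  refine iSup_le fun n => ?_
  refine le_trans (le_of_eq ?_) (sum_jumpProb_le_one r hr n t y ht)
  exact (Summable.tsum_finsetSum (fun k _ => ENNReal.summable)).symm

end Chain

/-! ### The closed and the open ASEP on `{0, 1, 2, …}`

A configuration is the finite set of its occupied sites. -/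

/-- The jump rates of closed ASEP: a particle at `k` moves to an empty site `k + 1` at rate `p`,
and, if `k ≠ 0`, to an empty site `k - 1` at rate `q`. -/
def closedRate (p q : ℝ≥0) (y x : Finset ℕ) : ℝ≥0∞ :=
  ∑ k ∈ y, ((if k + 1 ∉ y ∧ x = insert (k + 1) (y.erase k) then (p : ℝ≥0∞) else 0) +
    (if k ≠ 0 ∧ k - 1 ∉ y ∧ x = insert (k - 1) (y.erase k) then (q : ℝ≥0∞) else 0))

/-- The jump rates of ASEP with an open boundary at `0`: in addition, a particle is injected into
an empty site `0` at rate `α`, and a particle at `0` is ejected at rate `β`. -/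
def openRate (p q α β : ℝ≥0) (y x : Finset ℕ) : ℝ≥0∞ :=
  closedRate p q y x + (if 0 ∉ y ∧ x = insert 0 y then (α : ℝ≥0∞) else 0) +
    (if 0 ∈ y ∧ x = y.erase 0 then (β : ℝ≥0∞) else 0)

theorem tsum_ite_and_eq_ne_top (P : Prop) [Decidable P] (a : Finset ℕ) (c : ℝ≥0) :
    ∑' x : Finset ℕ, (if P ∧ x = a then (c : ℝ≥0∞) else 0) ≠ ∞ := by
  by_cases h : P <;> simp [h, tsum_ite_eq]

theorem tsum_closedRate_ne_top (p q : ℝ≥0) (y : Finset ℕ) : ∑' x, closedRate p q y x ≠ ∞ := by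
  unfold closedRate
  rw [Summable.tsum_finsetSum (fun k _ => ENNReal.summable)]
  refine ENNReal.sum_ne_top.2 fun k _ => ?_
  rw [ENNReal.tsum_add]
  refine ENNReal.add_ne_top.2 ⟨tsum_ite_and_eq_ne_top _ _ _, ?_⟩
  simp only [← and_assoc]
  exact tsum_ite_and_eq_ne_top _ _ _

theorem tsum_openRate_ne_top (p q α β : ℝ≥0) (y : Finset ℕ) :
    ∑' x, openRate p q α β y x ≠ ∞ := by
  unfold openRate
  rw [ENNReal.tsum_add, ENNReal.tsum_add]
  exact ENNReal.add_ne_top.2 ⟨ENNReal.add_ne_top.2 ⟨tsum_closedRate_ne_top p q y,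
    tsum_ite_and_eq_ne_top _ _ _⟩, tsum_ite_and_eq_ne_top _ _ _⟩

/-- The set of `n`-particle configurations. -/
abbrev Config (n : ℕ) : Type := {x : Finset ℕ // x.card = n}

/-- The probability that closed `n`-particle ASEP is in configuration `x` at time `t`, given that
it was initially in configuration `y`. -/
def closedProb (p q : ℝ≥0) (n : ℕ) (x y : Config n) (t : ℝ) : ℝ :=
  (transProb (closedRate p q) t y.1 x.1).toReal

/-- The probability that open ASEP with initial law `ν` is in configuration `x` at time `t`. -/
def openProb (p q α β : ℝ≥0) (ν : PMF (Finset ℕ)) (n : ℕ) (x : Config n) (t : ℝ) : ℝ :=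
  (∑' y, ν y * transProb (openRate p q α β) t y x.1).toReal

/-- The Laplace transform `∫₀^∞ e^{-st} f(t) dt`. -/
def laplace (f : ℝ → ℝ) (s : ℂ) : ℂ := ∫ t in Set.Ioi (0 : ℝ), Complex.exp (-s * t) * (f t : ℂ)

theorem tsum_laplace_le {ι : Type} (f : ι → ℝ → ℝ≥0∞) (hf : ∀ t, 0 ≤ t → ∑' i, f i t ≤ 1)
    (s : ℂ) (hs : 0 < s.re) :
    ∑' i, ‖laplace (fun t => (f i t).toReal) s‖ₑ ≤ ((Real.toNNReal (1 / s.re) : ℝ≥0) : ℝ≥0∞) := by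
  refine (ENNReal.tsum_le_tsum fun i => MeasureTheory.enorm_integral_le_lintegral_enorm _).trans
    ((tsum_lintegral_le _ _).trans ?_)
  have key : ∀ t ∈ Set.Ioi (0 : ℝ),
      ∑' i, ‖Complex.exp (-s * t) * ((f i t).toReal : ℂ)‖ₑ ≤
        ENNReal.ofReal (Real.exp (-s.re * t)) := by
    intro t ht
    have h0 : ∀ i, ‖Complex.exp (-s * t) * ((f i t).toReal : ℂ)‖ₑ ≤
        ENNReal.ofReal (Real.exp (-s.re * t)) * f i t := by
      intro i
      rw [enorm_mul]
      refine mul_le_mul (le_of_eq ?_) ?_ bot_le bot_le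
      · rw [← ofReal_norm, Complex.norm_exp]; simp
      · rw [← ofReal_norm, Complex.norm_real, Real.norm_eq_abs,
          abs_of_nonneg ENNReal.toReal_nonneg]
        exact ENNReal.ofReal_toReal_le
    refine (ENNReal.tsum_le_tsum h0).trans ?_
    rw [ENNReal.tsum_mul_left]
    exact (mul_le_mul le_rfl (hf t (le_of_lt ht)) bot_le bot_le).trans (mul_one _).le
  refine (MeasureTheory.setLIntegral_mono' measurableSet_Ioi key).trans (le_of_eq ?_)
  rw [← MeasureTheory.ofReal_integral_eq_lintegral_ofReal
    (integrableOn_exp_mul_Ioi (by linarith) 0)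
    (Filter.Eventually.of_forall fun u => (Real.exp_pos _).le),
    integral_exp_mul_Ioi (by linarith)]
  simp [ENNReal.ofReal]

/-! ### The spaces and the operators -/

theorem memlp_one {ι : Type} {E : ι → Type} [∀ i, NormedAddCommGroup (E i)] {f : ∀ i, E i} (h : ∑' i, ‖f i‖ₑ ≠ ∞) : Memℓp f 1 := by
  refine memℓp_gen ?_
  have := ENNReal.summable_toReal h
  simpa using this

theorem lp_one_enorm {ι : Type} {E : ι → Type} [∀ i, NormedAddCommGroup (E i)] (F : lp E 1) : ‖F‖ₑ = ∑' i, ‖F i‖ₑ := by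
  have hs : Summable fun i => ‖F i‖ := by
    have := (memℓp_gen_iff (by simp)).1 (lp.memℓp F)
    simpa using this
  rw [← ofReal_norm, lp.norm_eq_tsum_rpow (by simp)]
  simp only [ENNReal.toReal_one, Real.rpow_one, div_one]
  rw [ENNReal.ofReal_tsum_of_nonneg (fun _ => norm_nonneg _) hs]
  simp

section Operators

variable {ι κ : Type} {E : ι → Type} {G : κ → Type}
  [∀ i, NormedAddCommGroup (E i)] [∀ i, NormedSpace ℂ (E i)]
  [∀ k, NormedAddCommGroup (G k)] [∀ k, NormedSpace ℂ (G k)]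

/-- The bounded operator between `ℓ¹` direct sums given by a linear map `f` with
`‖f F‖ ≤ C ‖F‖`. -/
def opOfBound (f : lp E 1 → ∀ k, G k) (hadd : ∀ F F', f (F + F') = f F + f F')
    (hsmul : ∀ (c : ℂ) F, f (c • F) = c • f F) (C : ℝ≥0)
    (hb : ∀ F, ∑' k, ‖f F k‖ₑ ≤ C * ∑' i, ‖F i‖ₑ) : lp E 1 →L[ℂ] lp G 1 :=
  LinearMap.mkContinuous
    { toFun := fun F => ⟨f F, memlp_one (ne_top_of_le_ne_top
        (by rw [← lp_one_enorm]; exact ENNReal.mul_ne_top ENNReal.coe_ne_top enorm_ne_top) (hb F))⟩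
      map_add' := fun F F' => Subtype.ext (hadd F F')
      map_smul' := fun c F => Subtype.ext (hsmul c F) } C (fun F => by
        have h := hb F
        rw [← lp_one_enorm] at h
        have h' := (lp_one_enorm (⟨f F, memlp_one (ne_top_of_le_ne_top
          (by rw [← lp_one_enorm]; exact ENNReal.mul_ne_top ENNReal.coe_ne_top enorm_ne_top)
            (hb F))⟩ : lp G 1)).le.trans h
        simp only [enorm_eq_nnnorm] at h'
        exact_mod_cast h')

theorem norm_opOfBound_le (f : lp E 1 → ∀ k, G k) (hadd hsmul) (C : ℝ≥0) (hb) :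
    ‖opOfBound f hadd hsmul C hb‖₊ ≤ C :=
  LinearMap.mkContinuous_norm_le _ C.2 _

/-- The operator on `ℓ¹(ι)` with kernel `K`: `F ↦ (x ↦ ∑_y K(x, y) F(y))`. -/
def kernelOp (K : ι → ι → ℂ) (C : ℝ≥0) (hK : ∀ y, ∑' x, ‖K x y‖ₑ ≤ C) :
    lp (fun _ : ι => ℂ) 1 →L[ℂ] lp (fun _ : ι => ℂ) 1 :=
  have hb : ∀ F : lp (fun _ : ι => ℂ) 1,
      ∑' x, ∑' y, ‖K x y * F y‖ₑ ≤ C * ∑' y, ‖F y‖ₑ := fun F => by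
    rw [ENNReal.tsum_comm, ← ENNReal.tsum_mul_left]
    refine ENNReal.tsum_le_tsum fun y => ?_
    simp only [enorm_mul]
    rw [ENNReal.tsum_mul_right]
    exact mul_le_mul (hK y) le_rfl bot_le bot_le
  have hsum : ∀ (F : lp (fun _ : ι => ℂ) 1) x, Summable fun y => K x y * F y := fun F x => by
    have h : ∑' y, ‖K x y * F y‖ₑ ≠ ∞ := ne_top_of_le_ne_top
      (by rw [← lp_one_enorm]; exact ENNReal.mul_ne_top ENNReal.coe_ne_top enorm_ne_top)
      ((ENNReal.le_tsum x).trans (hb F))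
    have := ENNReal.summable_toReal h
    exact Summable.of_norm (by simpa using this)
  opOfBound (fun F x => ∑' y, K x y * F y)
    (fun F F' => by
      funext x
      simp only [lp.coeFn_add, Pi.add_apply, mul_add]
      exact (hsum F x).tsum_add (hsum F' x))
    (fun c F => by
      funext x
      simp only [lp.coeFn_smul, Pi.smul_apply, smul_eq_mul]
      rw [← tsum_mul_left]
      exact tsum_congr fun y => by ring)
    C (fun F => (ENNReal.tsum_le_tsum fun x => enorm_tsum_le_tsum_enorm).trans (hb F))

theorem norm_kernelOp_le (K : ι → ι → ℂ) (C : ℝ≥0) (hK : ∀ y, ∑' x, ‖K x y‖ₑ ≤ C) :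
    ‖kernelOp K C hK‖₊ ≤ C := by
  unfold kernelOp
  apply norm_opOfBound_le

end Operators

/-- The space `L¹` of the set of `n`-particle configurations. -/
abbrev Sp (n : ℕ) : Type := lp (fun _ : Config n => ℂ) 1

/-- The (`ℓ¹`) direct sum of the spaces `Sp n`. -/
abbrev DSum : Type := lp Sp 1

theorem tsum_config_comp_le {n m : ℕ} (F : Sp n) (f : Config m → ℂ) (P : Config m → Prop)
    (g : ∀ x, P x → Config n) (hg : ∀ x x' hx hx', g x hx = g x' hx' → x = x')
    (h0 : ∀ x, ¬ P x → f x = 0) (h1 : ∀ x hx, f x = F (g x hx)) :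
    ∑' x, ‖f x‖ₑ ≤ ((1 : ℝ≥0) : ℝ≥0∞) * ∑' y, ‖F y‖ₑ := by
  rw [ENNReal.coe_one, one_mul]
  have hsup : Function.support (fun x => ‖f x‖ₑ) ⊆ {x | P x} := by
    intro x hx
    by_contra h
    exact hx (by simp [h0 x h])
  rw [← tsum_subtype_eq_of_support_subset hsup]
  have hi : Function.Injective (fun x : {x | P x} => g x.1 x.2) :=
    fun x x' h => Subtype.ext (hg _ _ _ _ h)
  refine le_trans (le_of_eq ?_) (ENNReal.tsum_comp_le_tsum_of_injective hi (fun y => ‖F y‖ₑ))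
  exact tsum_congr fun x => by rw [h1 x.1 x.2]

theorem card_erase_zero {n : ℕ} (x : Config (n + 1)) (h : 0 ∈ x.1) : (x.1.erase 0).card = n := by
  rw [Finset.card_erase_of_mem h, x.2]; rfl

theorem card_insert_zero {n : ℕ} (x : Config n) (h : 0 ∉ x.1) : (insert 0 x.1).card = n + 1 := by
  rw [Finset.card_insert_of_notMem h, x.2]

/-- Multiplication by `δ(x₁)`, that is, by the indicator of `0` being occupied. -/
def deltaOp (n : ℕ) : Sp n →L[ℂ] Sp n :=
  opOfBound (fun F x => if 0 ∈ x.1 then F x else 0)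
    (fun F F' => by funext x; by_cases h : 0 ∈ x.1 <;> simp [h])
    (fun c F => by funext x; by_cases h : 0 ∈ x.1 <;> simp [h]) 1
    (fun F => tsum_config_comp_le F _ (fun x => 0 ∈ x.1) (fun x _ => x)
      (fun _ _ _ _ h => h) (fun x h => by simp [h]) (fun x h => by simp [h]))

/-- `(A F)(x₁, …, x_{n+1}) = δ(x₁) F(x₂, …, x_{n+1})`. -/
def injOp (n : ℕ) : Sp n →L[ℂ] Sp (n + 1) :=
  opOfBound (fun F x => if h : 0 ∈ x.1 then F ⟨x.1.erase 0, card_erase_zero x h⟩ else 0)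
    (fun F F' => by funext x; by_cases h : 0 ∈ x.1 <;> simp [h])
    (fun c F => by funext x; by_cases h : 0 ∈ x.1 <;> simp [h]) 1
    (fun F => tsum_config_comp_le F _ (fun x => 0 ∈ x.1)
      (fun x h => ⟨x.1.erase 0, card_erase_zero x h⟩)
      (fun x x' hx hx' h => by
        have h := congrArg (fun z : Config n => insert 0 z.1) h
        simp only [Finset.insert_erase hx, Finset.insert_erase hx'] at h
        exact Subtype.ext h)
      (fun x h => by simp [h]) (fun x h => by simp [h]))

/-- `(B F)(x₁, …, x_n) = (1 - δ(x₁)) F(0, x₁, …, x_n)`. -/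
def ejOp (n : ℕ) : Sp (n + 1) →L[ℂ] Sp n :=
  opOfBound (fun F x => if h : 0 ∉ x.1 then F ⟨insert 0 x.1, card_insert_zero x h⟩ else 0)
    (fun F F' => by funext x; by_cases h : 0 ∈ x.1 <;> simp [h])
    (fun c F => by funext x; by_cases h : 0 ∈ x.1 <;> simp [h]) 1
    (fun F => tsum_config_comp_le F _ (fun x => 0 ∉ x.1)
      (fun x h => ⟨insert 0 x.1, card_insert_zero x h⟩)
      (fun x x' hx hx' h => by
        have h := congrArg (fun z : Config (n + 1) => z.1.erase 0) h
        simp only [Finset.erase_insert hx, Finset.erase_insert hx'] at h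
        exact Subtype.ext h)
      (fun x h => by simp at h; simp [h]) (fun x h => by simp [h]))

theorem closedProb_laplace_le (p q : ℝ≥0) (n : ℕ) (s : ℂ) (hs : 0 < s.re) (y : Config n) :
    ∑' x, ‖laplace (closedProb p q n x y) s‖ₑ ≤ (Real.toNNReal (1 / s.re) : ℝ≥0) :=
  tsum_laplace_le (fun (x : Config n) t => transProb (closedRate p q) t y.1 x.1)
    (fun t ht => (ENNReal.tsum_comp_le_tsum_of_injective Subtype.val_injective
      (fun x => transProb (closedRate p q) t y.1 x)).trans
      (tsum_transProb_le_one _ (tsum_closedRate_ne_top p q) t ht y.1)) s hs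

/-- The operator `L_n(s)` whose kernel is the Laplace transform of the transition probabilities of
closed `n`-particle ASEP. -/
def resOp (p q : ℝ≥0) (s : ℂ) (hs : 0 < s.re) (n : ℕ) : Sp n →L[ℂ] Sp n :=
  kernelOp (fun x y => laplace (closedProb p q n x y) s) (Real.toNNReal (1 / s.re))
    (closedProb_laplace_le p q n s hs)

/-! ### Matrices with operator entries, acting on the direct sum -/

/-- The diagonal matrix with `(n, n)`-entry `T n`. -/
def diagMat (T : ∀ n, Sp n →L[ℂ] Sp n) (C : ℝ≥0) (hT : ∀ n, ‖T n‖₊ ≤ C) : DSum →L[ℂ] DSum :=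
  opOfBound (fun F n => T n (F n)) (fun F F' => by funext n; simp)
    (fun c F => by funext n; simp) C (fun F => by
      rw [← ENNReal.tsum_mul_left]
      refine ENNReal.tsum_le_tsum fun n => ((T n).le_opENorm _).trans ?_
      exact mul_le_mul (by simpa [enorm_eq_nnnorm] using hT n) le_rfl bot_le bot_le)

/-- The matrix with `(n + 1, n)`-entry `T n` and all other entries zero. -/
def subMat (T : ∀ n, Sp n →L[ℂ] Sp (n + 1)) (C : ℝ≥0) (hT : ∀ n, ‖T n‖₊ ≤ C) :
    DSum →L[ℂ] DSum :=
  opOfBound (fun F n => match n with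
      | 0 => 0
      | n + 1 => T n (F n))
    (fun F F' => by funext n; cases n <;> simp)
    (fun c F => by funext n; cases n <;> simp) C (fun F => by
      rw [← ENNReal.tsum_mul_left, tsum_eq_zero_add' ENNReal.summable]
      simp only [enorm_zero, zero_add]
      refine ENNReal.tsum_le_tsum fun n => ((T n).le_opENorm _).trans ?_
      exact mul_le_mul (by simpa [enorm_eq_nnnorm] using hT n) le_rfl bot_le bot_le)

/-- The matrix with `(n, n + 1)`-entry `T n` and all other entries zero. -/
def superMat (T : ∀ n, Sp (n + 1) →L[ℂ] Sp n) (C : ℝ≥0) (hT : ∀ n, ‖T n‖₊ ≤ C) :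
    DSum →L[ℂ] DSum :=
  opOfBound (fun F n => T n (F (n + 1))) (fun F F' => by funext n; simp)
    (fun c F => by funext n; simp) C (fun F => by
      rw [← ENNReal.tsum_mul_left]
      refine le_trans (ENNReal.tsum_le_tsum fun n => ((T n).le_opENorm _).trans
        (mul_le_mul (b := (C : ℝ≥0∞)) (by simpa [enorm_eq_nnnorm] using hT n) le_rfl bot_le bot_le))
        (ENNReal.tsum_comp_le_tsum_of_injective (add_left_injective 1)
          (fun n => (C : ℝ≥0∞) * ‖F n‖ₑ)))

/-- The matrix `δ`. -/
def deltaMat : DSum →L[ℂ] DSum := diagMat deltaOp 1 fun _ => norm_opOfBound_le _ _ _ _ _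

/-- The matrix `L(s)`. -/
def LMat (p q : ℝ≥0) (s : ℂ) (hs : 0 < s.re) : DSum →L[ℂ] DSum :=
  diagMat (resOp p q s hs) (Real.toNNReal (1 / s.re)) fun _ => norm_kernelOp_le _ _ _

/-- The matrix `A`. -/
def AMat : DSum →L[ℂ] DSum := subMat injOp 1 fun _ => norm_opOfBound_le _ _ _ _ _

/-- The matrix `B`. -/
def BMat : DSum →L[ℂ] DSum := superMat ejOp 1 fun _ => norm_opOfBound_le _ _ _ _ _

/-! ### The vector of the probabilities of open ASEP and its Laplace transform -/

theorem tsum_openProb_le_one (p q α β : ℝ≥0) (ν : PMF (Finset ℕ)) (t : ℝ) (ht : 0 ≤ t) :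
    ∑' x, ∑' y, ν y * transProb (openRate p q α β) t y x ≤ 1 := by
  rw [ENNReal.tsum_comm, ← ν.tsum_coe]
  refine ENNReal.tsum_le_tsum fun y => ?_
  rw [ENNReal.tsum_mul_left]
  exact (mul_le_mul le_rfl (tsum_transProb_le_one _ (tsum_openRate_ne_top p q α β) t ht y)
    bot_le bot_le).trans (mul_one _).le

theorem tsum_config (f : Finset ℕ → ℝ≥0∞) :
    ∑' n, ∑' x : Config n, f x.1 = ∑' x, f x := by
  rw [← ENNReal.tsum_sigma]
  exact (Equiv.sigmaFiberEquiv (Finset.card : Finset ℕ → ℕ)).tsum_eq f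

/-- An element of the direct sum, given by its components. -/
def mkVec (f : ∀ n, Config n → ℂ) (hf : ∑' n, ∑' x, ‖f n x‖ₑ ≠ ∞) : DSum :=
  ⟨fun n => ⟨f n, memlp_one (ne_top_of_le_ne_top hf (ENNReal.le_tsum n))⟩,
    memlp_one (by simpa only [lp_one_enorm] using hf)⟩

/-- The vector `P(t) = (P_n(·; t))_n` of the probabilities of open ASEP with initial law `ν`. -/
def PVec (p q α β : ℝ≥0) (ν : PMF (Finset ℕ)) (t : ℝ) (ht : 0 ≤ t) : DSum :=
  mkVec (fun n x => (openProb p q α β ν n x t : ℂ)) (by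
    refine ne_top_of_le_ne_top ENNReal.one_ne_top (le_trans ?_
      (tsum_openProb_le_one p q α β ν t ht))
    rw [← tsum_config]
    refine ENNReal.tsum_le_tsum fun n => ENNReal.tsum_le_tsum fun x => ?_
    rw [← ofReal_norm, Complex.norm_real, Real.norm_eq_abs, openProb,
      abs_of_nonneg ENNReal.toReal_nonneg]
    exact ENNReal.ofReal_toReal_le)

/-- The vector `P̂(s)` of the Laplace transforms of the probabilities of open ASEP. -/
def PHat (p q α β : ℝ≥0) (ν : PMF (Finset ℕ)) (s : ℂ) (hs : 0 < s.re) : DSum :=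
  mkVec (fun n x => laplace (openProb p q α β ν n x) s) (by
    rw [← ENNReal.tsum_sigma]
    refine ne_top_of_le_ne_top ENNReal.coe_ne_top (tsum_laplace_le
      (fun (z : Σ n, Config n) t => ∑' y, ν y * transProb (openRate p q α β) t y z.2.1)
      (fun t ht => ?_) s hs)
    refine (ENNReal.tsum_sigma (fun (n : ℕ) (x : Config n) =>
      ∑' y, ν y * transProb (openRate p q α β) t y x.1)).le.trans ?_
    exact (tsum_config (fun x => ∑' y, ν y * transProb (openRate p q α β) t y x)).le.trans (tsum_openProb_le_one p q α β ν t ht))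

end ASEP

end

/-!
Put `M = (α - β) δ + α A + β B`. Since open ASEP leaves a configuration at the rate of closed ASEP
plus `α - (α - β) δ`, its generator is that of closed ASEP plus `M - α`. The Laplace transform at
`s - α` of the law of open ASEP therefore satisfies the forward equation of closed ASEP at `s` with
source `P(0) + M P̂`, and solving for `P̂` gives `P̂ = L(s) (P(0) + M P̂)` (`PHat_eq`). As
`‖L(s)‖ ≤ 1 / Re s` and `‖M‖ ≤ 2 (α + β)`, the operator `1 - L(s) M` is invertible by the Neumann
series as soon as `Re s > 2 (α + β)`, and the formula follows.

The transition probabilities are defined by the first jump of the chain, so that the backward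
equation of the resolvent comes from the convolution theorem, jump number by jump number
(`jumpLaplace_succ`, `laplace_transProb_backward`). The decomposition at the last jump
(`jumpLaplace_succ'`) follows from it by induction on the number of jumps, and yields the forward
equation (`laplace_law_forward`). All sums over the states that can be reached in one jump, or from
which a given state can be reached in one jump, are finite.

To derive `PHat_eq`, the forward equation for `P̂` is paired with the backward equation for a column
of `L_n(s)` (`eq_tsum_of_forward_of_backward`). The generator of ASEP is unbounded, but this pairing
takes place within the `n`-particle configurations, where the exit rate of closed ASEP is at
most `n`, which makes the double sums absolutely convergent.
-/

noncomputable section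
namespace ASEP

/-! ### Laplace transforms of bounded nonnegative functions -/

section Laplace

open MeasureTheory

theorem integrableOn_exp_mul_toReal {f : ℝ → ℝ≥0∞} (hm : Measurable f)
    (hf : ∀ t, 0 ≤ t → f t ≤ 1) {s : ℂ} (hs : 0 < s.re) :
    IntegrableOn (fun t : ℝ => Complex.exp (-s * t) * ((f t).toReal : ℂ)) (Set.Ioi 0) := by
  refine Integrable.mono (integrableOn_exp_mul_complex_Ioi (a := -s) (by simpa using hs) 0)
    (by fun_prop) ?_
  refine (ae_restrict_iff' measurableSet_Ioi).2 (.of_forall fun t ht => ?_)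
  rw [norm_mul, Complex.norm_real, Real.norm_of_nonneg ENNReal.toReal_nonneg]
  exact mul_le_of_le_one_right (norm_nonneg _)
    (ENNReal.toReal_le_of_le_ofReal zero_le_one (by simpa using hf t (le_of_lt ht)))

theorem hasSum_laplace {ι : Type} [Countable ι] {f : ι → ℝ → ℝ≥0∞} (hm : ∀ i, Measurable (f i))
    (hf : ∀ t, 0 ≤ t → ∑' i, f i t ≤ 1) {s : ℂ} (hs : 0 < s.re) :
    HasSum (fun i => laplace (fun t => (f i t).toReal) s)
      (laplace (fun t => (∑' i, f i t).toReal) s) := by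
  have hmt : Measurable fun t => ∑' i, f i t := Measurable.tsum hm
  have hne : ∀ t, 0 < t → ∑' i, f i t ≠ ∞ := fun t ht =>
    ne_top_of_le_ne_top ENNReal.one_ne_top (hf t ht.le)
  have hsum : ∀ t, 0 < t → HasSum (fun i => (f i t).toReal) (∑' i, f i t).toReal := fun t ht => by
      rw [ENNReal.tsum_toReal_eq fun i => ENNReal.ne_top_of_tsum_ne_top (hne t ht) i]
      exact ENNReal.hasSum_toReal (hne t ht)
  refine hasSum_integral_of_dominated_convergence
    (fun i t => ‖Complex.exp (-s * t)‖ * (f i t).toReal) (fun i => ?_) (fun i => ?_) ?_ ?_ ?_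
  · have := hm i
    fun_prop
  · refine .of_forall fun t => ?_
    rw [norm_mul, Complex.norm_real, Real.norm_of_nonneg ENNReal.toReal_nonneg]
  · exact (ae_restrict_iff' measurableSet_Ioi).2
      (.of_forall fun t ht => (hsum t ht).summable.mul_left _)
  · refine (integrableOn_exp_mul_toReal hmt hf hs).norm.congr ?_
    refine (ae_restrict_iff' measurableSet_Ioi).2 (.of_forall fun t ht => ?_)
    simp only [norm_mul, Complex.norm_real, Real.norm_of_nonneg ENNReal.toReal_nonneg]
    rw [tsum_mul_left, (hsum t ht).tsum_eq]
  · refine (ae_restrict_iff' measurableSet_Ioi).2 (.of_forall fun t ht => ?_)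
    exact (Complex.hasSum_ofReal.2 (hsum t ht)).mul_left _

theorem laplace_exp {c : ℝ} (hc : 0 ≤ c) {s : ℂ} (hs : 0 < s.re) :
    laplace (fun t => Real.exp (-(c * t))) s = (s + c)⁻¹ := by
  have h : ∀ t : ℝ, Complex.exp (-s * t) * ((Real.exp (-(c * t)) : ℝ) : ℂ)
      = Complex.exp (-(s + c) * t) := fun t => by
    rw [Complex.ofReal_exp, ← Complex.exp_add]
    congr 1
    push_cast
    ring
  have hre : (-(s + c)).re < 0 := by
    simp only [Complex.neg_re, Complex.add_re, Complex.ofReal_re]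
    linarith
  simp only [laplace, h]
  rw [integral_exp_mul_complex_Ioi hre]
  simp only [Complex.ofReal_zero, mul_zero, Complex.exp_zero, neg_div_neg_eq, one_div]

/-- The Laplace transform of a convolution on the half-line is the product of the Laplace
transforms. -/
theorem laplace_conv {f g : ℝ → ℝ} {s : ℂ}
    (hf : IntegrableOn (fun t : ℝ => Complex.exp (-s * t) * (f t : ℂ)) (Set.Ioi 0))
    (hg : IntegrableOn (fun t : ℝ => Complex.exp (-s * t) * (g t : ℂ)) (Set.Ioi 0)) :
    laplace (fun t => ∫ u in Set.Ioc 0 t, f u * g (t - u)) s = laplace f s * laplace g s := by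
  have h := integral_posConvolution hf hg (ContinuousLinearMap.mul ℝ ℂ)
  simp only [ContinuousLinearMap.mul_apply'] at h
  rw [laplace, laplace, laplace, ← h]
  refine setIntegral_congr_fun measurableSet_Ioi fun t ht => ?_
  rw [← integral_complex_ofReal, intervalIntegral.integral_of_le (le_of_lt ht),
    ← integral_const_mul]
  refine integral_congr_ae (.of_forall fun u => ?_)
  simp only
  have : Complex.exp (-s * t) = Complex.exp (-s * u) * Complex.exp (-s * ((t - u : ℝ) : ℂ)) := by
    rw [← Complex.exp_add]
    congr 1
    push_cast
    ring
  rw [this]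
  push_cast
  ring

end Laplace

/-! ### The resolvent equations of a chain whose rates have finite rows and columns -/

section Resolvent

open MeasureTheory

variable {S : Type} {r : S → S → ℝ≥0∞}

theorem hasSum_tsum_of_finite_support {ι : Type} {c : S → ℂ} (hc : c.support.Finite)
    {f : ι → S → ℂ} {g : S → ℂ} (h : ∀ z, HasSum (fun i => f i z) (g z)) :
    HasSum (fun i => ∑' z, c z * f i z) (∑' z, c z * g z) := by
  have h0 : ∀ z ∉ hc.toFinset, c z = 0 := fun z hz => by simpa using hz
  have h1 : ∀ e : S → ℂ, ∑' z, c z * e z = ∑ z ∈ hc.toFinset, c z * e z := fun e =>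
    tsum_eq_sum fun z hz => by rw [h0 z hz, zero_mul]
  simp only [h1]
  exact hasSum_sum fun z _ => (h z).mul_left _

theorem tsum_comm_of_finite_support {c d : S → ℂ} (hc : c.support.Finite) (hd : d.support.Finite)
    (f : S → S → ℂ) :
    ∑' w, c w * ∑' z, d z * f w z = ∑' z, d z * ∑' w, c w * f w z := by
  have hc' : ∀ e : S → ℂ, ∑' z, c z * e z = ∑ z ∈ hc.toFinset, c z * e z := fun e =>
    tsum_eq_sum fun z hz => by rw [show c z = 0 by simpa using hz, zero_mul]
  have hd' : ∀ e : S → ℂ, ∑' z, d z * e z = ∑ z ∈ hd.toFinset, d z * e z := fun e =>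
    tsum_eq_sum fun z hz => by rw [show d z = 0 by simpa using hz, zero_mul]
  rw [hc' fun w => ∑' z, d z * f w z, hd' fun z => ∑' w, c w * f w z]
  simp only [hc', hd', Finset.mul_sum]
  rw [Finset.sum_comm]
  exact Finset.sum_congr rfl fun _ _ => Finset.sum_congr rfl fun _ _ => by ring

theorem add_exitRate_ne_zero (r : S → S → ℝ≥0∞) {s : ℂ} (hs : 0 < s.re) (y : S) :
    s + exitRate r y ≠ 0 := by
  intro h
  have h1 := congrArg Complex.re h
  have h2 : 0 ≤ exitRate r y := ENNReal.toReal_nonneg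
  simp at h1
  linarith

theorem finite_support_row (hrow : ∀ y, (r y).support.Finite) (y : S) :
    (fun z => ((r y z).toReal : ℂ)).support.Finite :=
  (hrow y).subset fun z hz h => hz (by simp [h])

theorem finite_support_col (hcol : ∀ x, (fun y => r y x).support.Finite) (x : S) :
    (fun z => ((r z x).toReal : ℂ)).support.Finite :=
  (hcol x).subset fun z hz h => hz (by simpa using congrArg ENNReal.toReal h)

variable [DecidableEq S]

theorem transProb_le_one (hr : ∀ y, ∑' z, r y z ≠ ∞) {t : ℝ} (ht : 0 ≤ t) (y x : S) :
    transProb r t y x ≤ 1 :=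
  (ENNReal.le_tsum x).trans (tsum_transProb_le_one r hr t ht y)

theorem jumpProb_le_one (hr : ∀ y, ∑' z, r y z ≠ ∞) {t : ℝ} (ht : 0 ≤ t) (k : ℕ) (y x : S) :
    jumpProb r k t y x ≤ 1 :=
  (ENNReal.le_tsum k).trans (transProb_le_one hr ht y x)

theorem tsum_law_transProb_le_one (hr : ∀ y, ∑' z, r y z ≠ ∞) (ν : PMF S) {t : ℝ} (ht : 0 ≤ t)
    (x : S) : ∑' y, ν y * transProb r t y x ≤ 1 := by
  rw [← ν.tsum_coe]
  refine ENNReal.tsum_le_tsum fun y => ?_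
  have h : transProb r t y x ≤ 1 := (ENNReal.le_tsum x).trans (tsum_transProb_le_one r hr t ht y)
  exact (mul_le_mul le_rfl h bot_le bot_le).trans (mul_one _).le

theorem transProb_zero (r : S → S → ℝ≥0∞) (y x : S) :
    transProb r 0 y x = if y = x then 1 else 0 := by
  rw [transProb, tsum_eq_zero_add' ENNReal.summable]
  simp [jumpProb]

/-- The Laplace transform of the probability of going from `y` to `x` in exactly `k` jumps. -/
def jumpLaplace (r : S → S → ℝ≥0∞) (s : ℂ) (k : ℕ) (y x : S) : ℂ :=
  laplace (fun t => (jumpProb r k t y x).toReal) s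

theorem jumpLaplace_zero (r : S → S → ℝ≥0∞) {s : ℂ} (hs : 0 < s.re) (y x : S) :
    (s + exitRate r y) * jumpLaplace r s 0 y x = if y = x then 1 else 0 := by
  by_cases h : y = x
  · simp only [jumpLaplace, jumpProb, if_pos h, ENNReal.toReal_ofReal (Real.exp_pos _).le]
    rw [laplace_exp (c := exitRate r y) ENNReal.toReal_nonneg hs, mul_inv_cancel₀ (add_exitRate_ne_zero r hs y)]
  · simp [jumpLaplace, jumpProb, h, laplace]

variable [Countable S]

theorem measurable_jumpProb (r : S → S → ℝ≥0∞) (k : ℕ) (y x : S) :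
    Measurable fun t => jumpProb r k t y x := by
  induction k generalizing y with
  | zero =>
    simp only [jumpProb]
    split_ifs <;> fun_prop
  | succ k ih =>
    have hG : Measurable fun v => ∑' z, r y z * jumpProb r k v z x :=
      Measurable.tsum fun z => (ih z).const_mul _
    have hset : MeasurableSet {a : ℝ × ℝ | 0 < a.2 ∧ a.2 ≤ a.1} :=
      (measurableSet_lt measurable_const measurable_snd).inter
        (measurableSet_le measurable_snd measurable_fst)
    have hF : Measurable fun a : ℝ × ℝ => ENNReal.ofReal (Real.exp (-(exitRate r y * a.2))) *
        ∑' z, r y z * jumpProb r k (a.1 - a.2) z x := by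
      refine Measurable.mul (by fun_prop) ?_
      exact hG.comp (measurable_fst.sub measurable_snd)
    have := (hF.indicator hset).lintegral_prod_right' (ν := volume)
    convert this using 2 with t
    rw [jumpProb, ← lintegral_indicator measurableSet_Ioc]
    rfl

theorem measurable_transProb (r : S → S → ℝ≥0∞) (y x : S) :
    Measurable fun t => transProb r t y x :=
  Measurable.tsum fun k => measurable_jumpProb r k y x

/-- The decomposition of a path at its first jump, after the Laplace transform. -/
theorem jumpLaplace_succ (hr : ∀ y, ∑' z, r y z ≠ ∞) (hrow : ∀ y, (r y).support.Finite)
    {s : ℂ} (hs : 0 < s.re) (k : ℕ) (y x : S) :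
    (s + exitRate r y) * jumpLaplace r s (k + 1) y x =
      ∑' z, ((r y z).toReal : ℂ) * jumpLaplace r s k z x := by
  have hrz : ∀ z, r y z ≠ ∞ := fun z => ne_top_of_le_ne_top (hr y) (ENNReal.le_tsum z)
  have hfin : ∀ e : S → ℝ≥0∞, ∑' z, r y z * e z = ∑ z ∈ (hrow y).toFinset, r y z * e z := fun e =>
    tsum_eq_sum fun z hz => by rw [show r y z = 0 by simpa using hz, zero_mul]
  set g : ℝ → ℝ := fun v => ∑ z ∈ (hrow y).toFinset, (r y z).toReal * (jumpProb r k v z x).toReal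
    with hg
  have hgE : ∀ v, 0 ≤ v → (∑' z, r y z * jumpProb r k v z x).toReal = g v := fun v hv => by
    rw [hfin, ENNReal.toReal_sum]
    · simp [hg]
    · exact fun z _ => ENNReal.mul_ne_top (hrz z)
        (ne_top_of_le_ne_top ENNReal.one_ne_top (jumpProb_le_one hr hv k z x))
  have hm : Measurable fun v => ∑' z, r y z * jumpProb r k v z x :=
    Measurable.tsum fun z => (measurable_jumpProb r k z x).const_mul _
  have htop : ∀ v, 0 ≤ v → ∑' z, r y z * jumpProb r k v z x < ∞ := fun v hv => by
    refine lt_of_le_of_lt (ENNReal.tsum_le_tsum fun z => ?_) (hr y).lt_top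
    exact (mul_le_mul le_rfl (jumpProb_le_one hr hv k z x) bot_le bot_le).trans (mul_one _).le
  have hconv : ∀ t ∈ Set.Ioi (0 : ℝ), (jumpProb r (k + 1) t y x).toReal =
      ∫ u in Set.Ioc 0 t, Real.exp (-(exitRate r y * u)) * g (t - u) := fun t _ => by
    rw [jumpProb, ← integral_toReal]
    · refine setIntegral_congr_fun measurableSet_Ioc fun u hu => ?_
      rw [ENNReal.toReal_mul, ENNReal.toReal_ofReal (Real.exp_pos _).le,
        hgE _ (sub_nonneg.2 hu.2)]
    · refine (Measurable.mul (by fun_prop) ?_).aemeasurable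
      exact hm.comp (measurable_const.sub measurable_id)
    · refine (ae_restrict_iff' measurableSet_Ioc).2 (.of_forall fun u hu => ?_)
      exact ENNReal.mul_lt_top ENNReal.ofReal_lt_top (htop _ (sub_nonneg.2 hu.2))
  have hint : ∀ z, IntegrableOn (fun t : ℝ => Complex.exp (-s * t) *
      ((jumpProb r k t z x).toReal : ℂ)) (Set.Ioi 0) := fun z =>
    integrableOn_exp_mul_toReal (measurable_jumpProb r k z x)
      (fun t ht => jumpProb_le_one hr ht k z x) hs
  have hgexp : ∀ t : ℝ, Complex.exp (-s * t) * (g t : ℂ) = ∑ z ∈ (hrow y).toFinset,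
      ((r y z).toReal : ℂ) * (Complex.exp (-s * t) * ((jumpProb r k t z x).toReal : ℂ)) :=
    fun t => by
      simp only [hg]
      push_cast
      rw [Finset.mul_sum]
      exact Finset.sum_congr rfl fun z _ => by ring
  have hgint : IntegrableOn (fun t : ℝ => Complex.exp (-s * t) * (g t : ℂ)) (Set.Ioi 0) := by
    simp only [hgexp]
    exact integrable_finsetSum _ fun z _ => (hint z).const_mul _
  have hexp : IntegrableOn (fun t : ℝ => Complex.exp (-s * t) *
      ((Real.exp (-(exitRate r y * t)) : ℝ) : ℂ)) (Set.Ioi 0) := by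
    have := integrableOn_exp_mul_toReal
      (f := fun t => ENNReal.ofReal (Real.exp (-(exitRate r y * t)))) (by fun_prop)
      (fun t ht => by
        refine ENNReal.ofReal_le_one.2 (Real.exp_le_one_iff.2 ?_)
        have : 0 ≤ exitRate r y * t := mul_nonneg ENNReal.toReal_nonneg ht
        linarith) hs
    simpa only [ENNReal.toReal_ofReal (Real.exp_pos _).le] using this
  have hglap : laplace g s = ∑' z, ((r y z).toReal : ℂ) * jumpLaplace r s k z x := by
    rw [tsum_eq_sum (s := (hrow y).toFinset)
      fun z hz => by rw [show r y z = 0 by simpa using hz]; simp]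
    simp only [laplace, hgexp, jumpLaplace]
    rw [integral_finsetSum _ fun z _ => (hint z).const_mul _]
    exact Finset.sum_congr rfl fun z _ => integral_const_mul _ _
  have hlap : jumpLaplace r s (k + 1) y x = (s + exitRate r y)⁻¹ * laplace g s := by
    rw [← laplace_exp (c := exitRate r y) ENNReal.toReal_nonneg hs, ← laplace_conv hexp hgint, jumpLaplace]
    refine setIntegral_congr_fun measurableSet_Ioi fun t ht => ?_
    simp only
    rw [hconv t ht]
  rw [hlap, mul_inv_cancel_left₀ (add_exitRate_ne_zero r hs y), hglap]

/-- The decomposition of a path at its last jump, after the Laplace transform. -/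
theorem jumpLaplace_succ' (hr : ∀ y, ∑' z, r y z ≠ ∞) (hrow : ∀ y, (r y).support.Finite)
    (hcol : ∀ x, (fun y => r y x).support.Finite)
    {s : ℂ} (hs : 0 < s.re) (k : ℕ) (y x : S) :
    (s + exitRate r x) * jumpLaplace r s (k + 1) y x =
      ∑' z, ((r z x).toReal : ℂ) * jumpLaplace r s k y z := by
  have hne := add_exitRate_ne_zero r hs
  have h0 : ∀ y x, jumpLaplace r s 0 y x = if y = x then (s + exitRate r y)⁻¹ else 0 :=
    fun y x => by
      apply mul_left_cancel₀ (hne y)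
      rw [jumpLaplace_zero r hs]
      split_ifs
      · rw [mul_inv_cancel₀ (hne y)]
      · simp
  induction k generalizing y with
  | zero =>
    apply mul_left_cancel₀ (hne y)
    rw [mul_left_comm, jumpLaplace_succ hr hrow hs]
    have h1 : ∑' z, ((r y z).toReal : ℂ) * jumpLaplace r s 0 z x =
        ((r y x).toReal : ℂ) * (s + exitRate r x)⁻¹ := by
      rw [tsum_eq_single x fun z hz => by rw [h0, if_neg hz, mul_zero], h0, if_pos rfl]
    have h2 : ∑' z, ((r z x).toReal : ℂ) * jumpLaplace r s 0 y z =
        ((r y x).toReal : ℂ) * (s + exitRate r y)⁻¹ := by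
      rw [tsum_eq_single y fun z hz => by rw [h0, if_neg (Ne.symm hz), mul_zero], h0, if_pos rfl]
    rw [h1, h2]
    field_simp [hne x, hne y]
  | succ k ih =>
    apply mul_left_cancel₀ (hne y)
    rw [mul_left_comm, jumpLaplace_succ hr hrow hs, ← tsum_mul_left, ← tsum_mul_left]
    calc ∑' w, (s + exitRate r x) * (((r y w).toReal : ℂ) * jumpLaplace r s (k + 1) w x)
        = ∑' w, ((r y w).toReal : ℂ) * ∑' z, ((r z x).toReal : ℂ) * jumpLaplace r s k w z :=
          tsum_congr fun w => by rw [← ih, mul_left_comm]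
      _ = ∑' z, ((r z x).toReal : ℂ) * ∑' w, ((r y w).toReal : ℂ) * jumpLaplace r s k w z :=
          tsum_comm_of_finite_support (finite_support_row hrow y) (finite_support_col hcol x) _
      _ = _ := tsum_congr fun z => by rw [← jumpLaplace_succ hr hrow hs, mul_left_comm]

theorem hasSum_jumpLaplace (hr : ∀ y, ∑' z, r y z ≠ ∞) {s : ℂ} (hs : 0 < s.re) (y x : S) :
    HasSum (fun k => jumpLaplace r s k y x) (laplace (fun t => (transProb r t y x).toReal) s) :=
  hasSum_laplace (fun k => measurable_jumpProb r k y x)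
    (fun _ ht => transProb_le_one hr ht y x) hs

/-- The backward equation of the resolvent, the sum over `k` of `jumpLaplace_succ`. -/
theorem laplace_transProb_backward (hr : ∀ y, ∑' z, r y z ≠ ∞)
    (hrow : ∀ y, (r y).support.Finite) {s : ℂ} (hs : 0 < s.re) (y x : S) :
    (s + exitRate r y) * laplace (fun t => (transProb r t y x).toReal) s =
      (if y = x then 1 else 0) +
        ∑' z, ((r y z).toReal : ℂ) * laplace (fun t => (transProb r t z x).toReal) s := by
  have h1 := (hasSum_jumpLaplace hr hs y x).mul_left (s + exitRate r y)
  have h2 := hasSum_tsum_of_finite_support (finite_support_row hrow y)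
    fun z => hasSum_jumpLaplace hr hs z x
  simp only [← jumpLaplace_succ hr hrow hs] at h2
  rw [← h1.tsum_eq, h1.summable.tsum_eq_zero_add, h2.tsum_eq, jumpLaplace_zero r hs]

/-- The forward equation of the resolvent, applied to an initial law; it is the sum over the number
of jumps of `jumpLaplace_succ'`. -/
theorem laplace_law_forward (hr : ∀ y, ∑' z, r y z ≠ ∞) (hrow : ∀ y, (r y).support.Finite)
    (hcol : ∀ x, (fun y => r y x).support.Finite) (ν : PMF S) {s : ℂ} (hs : 0 < s.re) (x : S) :
    (s + exitRate r x) * laplace (fun t => (∑' y, ν y * transProb r t y x).toReal) s =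
      ((ν x).toReal : ℂ) + ∑' z, ((r z x).toReal : ℂ) *
        laplace (fun t => (∑' y, ν y * transProb r t y z).toReal) s := by
  have hm : ∀ k x, Measurable fun t => ∑' y, ν y * jumpProb r k t y x := fun k x =>
    Measurable.tsum fun y => (measurable_jumpProb r k y x).const_mul _
  have hswap : ∀ t x, ∑' y, ν y * transProb r t y x = ∑' k, ∑' y, ν y * jumpProb r k t y x :=
    fun t x => by
      simp only [transProb, ← ENNReal.tsum_mul_left]
      exact ENNReal.tsum_comm
  -- the contribution of the paths with exactly `k` jumps
  set Q : ℕ → S → ℂ := fun k x => laplace (fun t => (∑' y, ν y * jumpProb r k t y x).toReal) s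
    with hQ
  have hQsum : ∀ x, HasSum (fun k => Q k x)
      (laplace (fun t => (∑' y, ν y * transProb r t y x).toReal) s) := fun x => by
    simp only [hswap]
    exact hasSum_laplace (fun k => hm k x)
      (fun t ht => by rw [← hswap]; exact tsum_law_transProb_le_one hr ν ht x) hs
  have hQy : ∀ k x, HasSum (fun y => ((ν y).toReal : ℂ) * jumpLaplace r s k y x) (Q k x) :=
    fun k x => by
      have h := hasSum_laplace (f := fun y t => ν y * jumpProb r k t y x)
        (fun y => (measurable_jumpProb r k y x).const_mul _) (fun t ht => by
          refine le_trans ?_ (tsum_law_transProb_le_one hr ν ht x)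
          exact ENNReal.tsum_le_tsum fun y => mul_le_mul le_rfl (ENNReal.le_tsum k) bot_le bot_le)
        hs
      convert! h using 2 with y
      simp only [jumpLaplace, laplace, ENNReal.toReal_mul]
      rw [← integral_const_mul]
      refine integral_congr_ae (.of_forall fun t => ?_)
      simp only
      push_cast
      ring
  have hQ0 : (s + exitRate r x) * Q 0 x = (ν x).toReal := by
    rw [← (hQy 0 x).tsum_eq, tsum_eq_single x, mul_left_comm, jumpLaplace_zero r hs, if_pos rfl,
      mul_one]
    intro y hy
    have := jumpLaplace_zero r hs y x
    rw [if_neg hy] at this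
    rw [(mul_eq_zero.1 this).resolve_left (add_exitRate_ne_zero r hs y), mul_zero]
  have hQs : ∀ k, (s + exitRate r x) * Q (k + 1) x = ∑' z, ((r z x).toReal : ℂ) * Q k z :=
    fun k => by
      have h1 := hasSum_tsum_of_finite_support (finite_support_col hcol x) fun z => hQy k z
      rw [← h1.tsum_eq, ← (hQy (k + 1) x).tsum_eq, ← tsum_mul_left]
      refine tsum_congr fun y => ?_
      rw [mul_left_comm, jumpLaplace_succ' hr hrow hcol hs, ← tsum_mul_left]
      exact tsum_congr fun z => by ring
  have h1 := (hQsum x).mul_left (s + exitRate r x)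
  have h2 := hasSum_tsum_of_finite_support (finite_support_col hcol x) hQsum
  rw [← h1.tsum_eq, h1.summable.tsum_eq_zero_add, hQ0, ← h2.tsum_eq]
  simp only [hQs]

end Resolvent
/-! ### The rates of closed and open ASEP -/

section Rates

/-- A jump of closed ASEP moves one particle from some `k` to an empty neighbouring site `l`. -/
theorem exists_of_closedRate_ne_zero {p q : ℝ≥0} {y x : Finset ℕ} (h : closedRate p q y x ≠ 0) :
    ∃ k ∈ y, ∃ l, l ∉ y ∧ x = insert l (y.erase k) ∧ l ≤ k + 1 ∧ k ≤ l + 1 := by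
  obtain ⟨k, hk, hne⟩ := Finset.exists_ne_zero_of_sum_ne_zero h
  by_cases h1 : k + 1 ∉ y ∧ x = insert (k + 1) (y.erase k)
  · exact ⟨k, hk, k + 1, h1.1, h1.2, le_rfl, by omega⟩
  · by_cases h2 : k ≠ 0 ∧ k - 1 ∉ y ∧ x = insert (k - 1) (y.erase k)
    · exact ⟨k, hk, k - 1, h2.2.1, h2.2.2, by omega, by omega⟩
    · exact absurd (by rw [if_neg h1, if_neg h2, add_zero]) hne

theorem card_eq_of_closedRate_ne_zero {p q : ℝ≥0} {y x : Finset ℕ} (h : closedRate p q y x ≠ 0) :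
    x.card = y.card := by
  obtain ⟨k, hk, l, hl, rfl, -, -⟩ := exists_of_closedRate_ne_zero h
  rw [Finset.card_insert_of_notMem fun h => hl (Finset.mem_of_mem_erase h),
    Finset.card_erase_add_one hk]

/-- A jump of open ASEP changes the rightmost occupied site by at most one, in both directions of
time; this makes the rows and the columns of the rates finite. -/
theorem subset_range_of_openRate_ne_zero {p q α β : ℝ≥0} {y x : Finset ℕ}
    (h : openRate p q α β y x ≠ 0) (N : ℕ) :
    (y ⊆ Finset.range N → x ⊆ Finset.range (N + 1)) ∧
      (x ⊆ Finset.range N → y ⊆ Finset.range (N + 1)) := by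
  have hcases : closedRate p q y x ≠ 0 ∨ x = insert 0 y ∨ x = y.erase 0 := by
    by_contra! hc
    exact h (by simp [openRate, hc.1, hc.2.1, hc.2.2])
  simp only [Finset.subset_iff, Finset.mem_range]
  rcases hcases with hc | rfl | rfl
  · obtain ⟨k, hk, l, -, rfl, h1, h2⟩ := exists_of_closedRate_ne_zero hc
    refine ⟨fun hy a ha => ?_, fun hx a ha => ?_⟩
    · rcases Finset.mem_insert.1 ha with rfl | ha
      · have := hy hk
        omega
      · have := hy (Finset.mem_of_mem_erase ha)
        omega
    · by_cases hak : a = k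
      · have := hx (Finset.mem_insert_self l _)
        omega
      · have := hx (Finset.mem_insert_of_mem (Finset.mem_erase.2 ⟨hak, ha⟩))
        omega
  · refine ⟨fun hy a ha => ?_, fun hx a ha => (hx (Finset.mem_insert_of_mem ha)).trans_le (by omega)⟩
    rcases Finset.mem_insert.1 ha with rfl | ha
    · omega
    · have := hy ha
      omega
  · refine ⟨fun hy a ha => (hy (Finset.mem_of_mem_erase ha)).trans_le (by omega), fun hx a ha => ?_⟩
    by_cases ha0 : a = 0
    · omega
    · have := hx (Finset.mem_erase.2 ⟨ha0, ha⟩)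
      omega

theorem exists_subset_range (x : Finset ℕ) : ∃ N, x ⊆ Finset.range N :=
  ⟨x.sup id + 1, fun _ ha => Finset.mem_range.2 (Nat.lt_succ_of_le (Finset.le_sup (f := id) ha))⟩

theorem finite_support_openRate (p q α β : ℝ≥0) (y : Finset ℕ) :
    (openRate p q α β y).support.Finite := by
  obtain ⟨N, hN⟩ := exists_subset_range y
  exact (Finset.range (N + 1)).powerset.finite_toSet.subset fun x hx =>
    Finset.mem_coe.2 (Finset.mem_powerset.2 ((subset_range_of_openRate_ne_zero hx N).1 hN))

theorem finite_support_openRate_col (p q α β : ℝ≥0) (x : Finset ℕ) :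
    (fun y => openRate p q α β y x).support.Finite := by
  obtain ⟨N, hN⟩ := exists_subset_range x
  exact (Finset.range (N + 1)).powerset.finite_toSet.subset fun y hy =>
    Finset.mem_coe.2 (Finset.mem_powerset.2 ((subset_range_of_openRate_ne_zero hy N).2 hN))

theorem openRate_zero_zero (p q : ℝ≥0) : openRate p q 0 0 = closedRate p q := by
  funext y x
  simp [openRate]

theorem tsum_closedRate_le {p q : ℝ≥0} (hpq : p + q = 1) (y : Finset ℕ) :
    ∑' x, closedRate p q y x ≤ y.card := by
  have hite : ∀ (P : Prop) [Decidable P] (a : Finset ℕ) (c : ℝ≥0),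
      ∑' x : Finset ℕ, (if P ∧ x = a then (c : ℝ≥0∞) else 0) ≤ c := fun P _ a c => by
    by_cases h : P <;> simp [h, tsum_ite_eq]
  unfold closedRate
  rw [Summable.tsum_finsetSum fun k _ => ENNReal.summable]
  refine (Finset.sum_le_card_nsmul y _ 1 fun k _ => ?_).trans (by simp)
  rw [ENNReal.tsum_add, ← ENNReal.coe_one, ← hpq, ENNReal.coe_add]
  simp only [← and_assoc]
  exact add_le_add (hite _ _ _) (hite _ _ _)

theorem exitRate_openRate (p q α β : ℝ≥0) (y : Finset ℕ) :
    exitRate (openRate p q α β) y = exitRate (closedRate p q) y + if 0 ∈ y then (β : ℝ) else α := by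
  unfold exitRate openRate
  rw [ENNReal.tsum_add, ENNReal.tsum_add, ENNReal.toReal_add, ENNReal.toReal_add]
  · by_cases h : 0 ∈ y <;> simp [h, tsum_ite_eq]
  · exact tsum_closedRate_ne_top p q y
  · exact tsum_ite_and_eq_ne_top _ _ _
  · exact ENNReal.add_ne_top.2 ⟨tsum_closedRate_ne_top p q y, tsum_ite_and_eq_ne_top _ _ _⟩
  · exact tsum_ite_and_eq_ne_top _ _ _

theorem tsum_eq_tsum_config {n : ℕ} {c : Finset ℕ → ℂ}
    (hc : ∀ w, c w ≠ 0 → w.card = n) :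
    ∑' w, c w = ∑' w : Config n, c w.1 :=
  (tsum_subtype_eq_of_support_subset (s := {w : Finset ℕ | w.card = n}) hc).symm

/-- The inflow into `z` from a vector `f` splits into the inflow of closed ASEP, the injections and
the ejections. -/
theorem tsum_openRate_mul (p q α β : ℝ≥0) {n : ℕ} (z : Config n) (f : Finset ℕ → ℂ) :
    ∑' w, ((openRate p q α β w z.1).toReal : ℂ) * f w =
      ∑' w : Config n, ((closedRate p q w.1 z.1).toReal : ℂ) * f w.1 +
        (if 0 ∈ z.1 then (α : ℝ) * f (z.1.erase 0) else 0) +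
        (if 0 ∉ z.1 then (β : ℝ) * f (insert 0 z.1) else 0) := by
  have hinj : ∀ w : Finset ℕ, (0 ∉ w ∧ z.1 = insert 0 w) ↔ (0 ∈ z.1 ∧ w = z.1.erase 0) := by
    refine fun w => ⟨fun h => ?_, fun h => ?_⟩
    · rw [h.2, Finset.erase_insert h.1]
      simp
    · rw [h.2, Finset.insert_erase h.1]
      simp
  have hej : ∀ w : Finset ℕ, (0 ∈ w ∧ z.1 = w.erase 0) ↔ (0 ∉ z.1 ∧ w = insert 0 z.1) := by
    refine fun w => ⟨fun h => ?_, fun h => ?_⟩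
    · rw [h.2, Finset.insert_erase h.1]
      simp
    · rw [h.2, Finset.erase_insert h.1]
      simp
  have hsplit : ∀ w, ((openRate p q α β w z.1).toReal : ℂ) * f w =
      ((closedRate p q w z.1).toReal : ℂ) * f w +
        (if w = z.1.erase 0 then (if 0 ∈ z.1 then (α : ℝ) * f (z.1.erase 0) else 0) else 0) +
        (if w = insert 0 z.1 then (if 0 ∉ z.1 then (β : ℝ) * f (insert 0 z.1) else 0) else 0) := by
    intro w
    have hne : closedRate p q w z.1 ≠ ∞ :=
      ne_top_of_le_ne_top (tsum_closedRate_ne_top p q w) (ENNReal.le_tsum z.1)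
    have h1 : (if 0 ∉ w ∧ z.1 = insert 0 w then (α : ℝ≥0∞) else 0) ≠ ∞ := by
      split_ifs <;> simp
    have h2 : (if 0 ∈ w ∧ z.1 = w.erase 0 then (β : ℝ≥0∞) else 0) ≠ ∞ := by
      split_ifs <;> simp
    rw [openRate, ENNReal.toReal_add (ENNReal.add_ne_top.2 ⟨hne, h1⟩) h2, ENNReal.toReal_add hne h1]
    simp only [hinj, hej]
    push_cast
    rw [add_mul, add_mul]
    congr 1
    · congr 1
      by_cases ha : 0 ∈ z.1 <;> by_cases hb : w = z.1.erase 0 <;> simp [ha, hb]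
    · by_cases ha : 0 ∈ z.1 <;> by_cases hb : w = insert 0 z.1 <;> simp [ha, hb]
  have hs1 : Summable fun w => ((closedRate p q w z.1).toReal : ℂ) * f w := by
    refine summable_of_hasFiniteSupport ((finite_support_col (fun x => ?_) z.1).subset
      (Function.support_mul_subset_left _ _))
    rw [← openRate_zero_zero]
    exact finite_support_openRate_col p q 0 0 x
  have hs2 := (hasSum_ite_eq (z.1.erase 0)
    (if 0 ∈ z.1 then ((α : ℝ) : ℂ) * f (z.1.erase 0) else 0))
  have hs3 := (hasSum_ite_eq (insert 0 z.1)
    (if 0 ∉ z.1 then ((β : ℝ) : ℂ) * f (insert 0 z.1) else 0))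
  rw [tsum_congr hsplit, (hs1.add hs2.summable).tsum_add hs3.summable,
    hs1.tsum_add hs2.summable, hs2.tsum_eq, hs3.tsum_eq]
  congr 2
  refine tsum_eq_tsum_config fun w hw => ?_
  rw [← card_eq_of_closedRate_ne_zero (p := p) (q := q) (y := w) (x := z.1) fun h => hw (by simp [h]),
    z.2]

end Rates

/-! ### The perturbation formula -/

section Perturbation

/-- A solution `f` of the forward equation with source `g` is given at `x` by pairing `g` with the
solution `K` of the backward equation with source at `x`: the transition terms in
`∑ e(z) f(z) K(z)` agree by Fubini. -/
theorem eq_tsum_of_forward_of_backward {ι : Type} [DecidableEq ι] {K f g e : ι → ℂ}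
    {ρ : ι → ι → ℂ} {x : ι}
    (hfwd : ∀ z, e z * f z = g z + ∑' w, ρ w z * f w)
    (hbwd : ∀ z, e z * K z = (if z = x then 1 else 0) + ∑' w, ρ z w * K w)
    (hg : Summable fun z => K z * g z)
    (hρ : Summable fun a : ι × ι => ρ a.1 a.2 * f a.1 * K a.2) :
    f x = ∑' z, K z * g z := by
  have h1 : HasSum (fun z => e z * f z * K z)
      (∑' z, K z * g z + ∑' a : ι × ι, ρ a.1 a.2 * f a.1 * K a.2) := by
    have h := hρ.prod_symm.prod.hasSum
    rw [← hρ.prod_symm.tsum_prod, ← (Equiv.prodComm ι ι).tsum_eq] at h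
    convert! hg.hasSum.add h using 2 with z
    rw [hfwd, add_mul, ← tsum_mul_right, mul_comm (g z)]
    rfl
  have h2 : HasSum (fun z => e z * f z * K z)
      (f x + ∑' a : ι × ι, ρ a.1 a.2 * f a.1 * K a.2) := by
    have h := hρ.prod.hasSum
    rw [← hρ.tsum_prod] at h
    convert! (hasSum_ite_eq x (f x)).add h using 2 with z
    rw [mul_right_comm, hbwd, add_mul, ← tsum_mul_right]
    congr 1
    · by_cases hz : z = x <;> simp [hz]
    · exact tsum_congr fun w => by ring
  exact add_right_cancel (h2.unique h1)

theorem summable_of_tsum_enorm_ne_top {ι : Type} {f : ι → ℂ} (h : ∑' i, ‖f i‖ₑ ≠ ∞) :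
    Summable f :=
  Summable.of_norm (by simpa using ENNReal.summable_toReal h)

theorem enorm_toReal_le (a : ℝ≥0∞) : ‖(a.toReal : ℂ)‖ₑ ≤ a := by
  rw [← ofReal_norm, Complex.norm_real, Real.norm_of_nonneg ENNReal.toReal_nonneg]
  exact ENNReal.ofReal_toReal_le

theorem tsum_enorm_ne_top {n : ℕ} (F : Sp n) : ∑' z, ‖F z‖ₑ ≠ ∞ := by
  rw [← lp_one_enorm]
  exact enorm_ne_top

variable (p q α β : ℝ≥0)

theorem enorm_laplace_closedProb_le (n : ℕ) {s : ℂ} (hs : 0 < s.re) (x z : Config n) :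
    ‖laplace (closedProb p q n x z) s‖ₑ ≤ (Real.toNNReal (1 / s.re) : ℝ≥0) :=
  (ENNReal.le_tsum (f := fun x => ‖laplace (closedProb p q n x z) s‖ₑ) x).trans
    (closedProb_laplace_le p q n s hs z)

/-- The boundary operator `(α - β) δ + α A + β B`. -/
def boundaryOp : DSum →L[ℂ] DSum :=
  (((α : ℝ) : ℂ) - ((β : ℝ) : ℂ)) • deltaMat + ((α : ℝ) : ℂ) • AMat + ((β : ℝ) : ℂ) • BMat

theorem boundaryOp_apply {F : DSum} {f : Finset ℕ → ℂ} (hF : ∀ n x, F n x = f x.1) (n : ℕ)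
    (z : Config n) : boundaryOp α β F n z =
      (if 0 ∈ z.1 then ((α : ℝ) - (β : ℝ)) * f z.1 else 0) +
        (if 0 ∈ z.1 then (α : ℝ) * f (z.1.erase 0) else 0) +
        (if 0 ∉ z.1 then (β : ℝ) * f (insert 0 z.1) else 0) := by
  have h1 : deltaMat F n z = if 0 ∈ z.1 then f z.1 else 0 := by
    rw [← hF]
    rfl
  have h2 : AMat F n z = if 0 ∈ z.1 then f (z.1.erase 0) else 0 := by
    cases n with
    | zero =>
      have : z.1 = ∅ := Finset.card_eq_zero.1 z.2
      simp only [this, Finset.notMem_empty, if_false]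
      rfl
    | succ n =>
      by_cases h : 0 ∈ z.1
      · rw [if_pos h]
        refine Eq.trans ?_ (hF n ⟨z.1.erase 0, card_erase_zero z h⟩)
        exact dif_pos h
      · rw [if_neg h]
        exact dif_neg h
  have h3 : BMat F n z = if 0 ∉ z.1 then f (insert 0 z.1) else 0 := by
    by_cases h : 0 ∉ z.1
    · rw [if_pos h]
      refine Eq.trans ?_ (hF (n + 1) ⟨insert 0 z.1, card_insert_zero z h⟩)
      exact dif_pos h
    · rw [if_neg h]
      exact dif_neg h
  have h : boundaryOp α β F n z = (((α : ℝ) : ℂ) - ((β : ℝ) : ℂ)) * deltaMat F n z +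
      ((α : ℝ) : ℂ) * AMat F n z + ((β : ℝ) : ℂ) * BMat F n z := rfl
  rw [h, h1, h2, h3]
  simp only [mul_ite, mul_zero]

theorem norm_boundaryOp_le : ‖boundaryOp α β‖ ≤ 2 * (α + β) := by
  have hd : ‖deltaMat‖₊ ≤ 1 := by
    unfold deltaMat diagMat
    apply norm_opOfBound_le
  have hA : ‖AMat‖₊ ≤ 1 := by
    unfold AMat subMat
    apply norm_opOfBound_le
  have hB : ‖BMat‖₊ ≤ 1 := by
    unfold BMat superMat
    apply norm_opOfBound_le
  have hd' : ‖deltaMat‖ ≤ 1 := hd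
  have hA' : ‖AMat‖ ≤ 1 := hA
  have hB' : ‖BMat‖ ≤ 1 := hB
  have hα : ‖((α : ℝ) : ℂ)‖ = α := by simp
  have hβ : ‖((β : ℝ) : ℂ)‖ = β := by simp
  have hαβ : ‖((α : ℝ) : ℂ) - ((β : ℝ) : ℂ)‖ ≤ α + β := (norm_sub_le _ _).trans_eq (by rw [hα, hβ])
  calc ‖boundaryOp α β‖ ≤ ‖((α : ℝ) : ℂ) - ((β : ℝ) : ℂ)‖ * ‖deltaMat‖ +
        ‖((α : ℝ) : ℂ)‖ * ‖AMat‖ + ‖((β : ℝ) : ℂ)‖ * ‖BMat‖ := by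
        refine (norm_add₃_le).trans ?_
        simp only [norm_smul, le_refl]
    _ ≤ (α + β) * 1 + α * 1 + β * 1 := by rw [hα, hβ]; gcongr
    _ = 2 * (α + β) := by ring

variable {p q α β}

theorem norm_LMat_le {s : ℂ} (hs : 0 < s.re) : ‖LMat p q s hs‖ ≤ 1 / s.re := by
  have h : ‖LMat p q s hs‖₊ ≤ Real.toNNReal (1 / s.re) := by
    unfold LMat diagMat
    apply norm_opOfBound_le
  have h' : ‖LMat p q s hs‖ ≤ (Real.toNNReal (1 / s.re) : ℝ≥0) := h
  rwa [Real.coe_toNNReal _ (by positivity)] at h'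

/-- The Laplace transform of the law of open ASEP is the resolvent of closed ASEP, applied to the
initial law increased by the boundary terms. -/
theorem PHat_eq (hpq : p + q = 1) (ν : PMF (Finset ℕ)) {s : ℂ} (hs : 0 < s.re)
    (hsα : 0 < (s - ((α : ℝ) : ℂ)).re) :
    PHat p q α β ν (s - ((α : ℝ) : ℂ)) hsα =
      LMat p q s hs (PVec p q α β ν 0 le_rfl +
        boundaryOp α β (PHat p q α β ν (s - ((α : ℝ) : ℂ)) hsα)) := by
  set F := PHat p q α β ν (s - ((α : ℝ) : ℂ)) hsα with hFdef
  set f : Finset ℕ → ℂ := fun z =>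
    laplace (fun t => (∑' y, ν y * transProb (openRate p q α β) t y z).toReal)
      (s - ((α : ℝ) : ℂ)) with hf
  have hF : ∀ n x, F n x = f x.1 := fun n x => rfl
  set G := PVec p q α β ν 0 le_rfl + boundaryOp α β F with hG
  have hGz : ∀ n z, G n z = ((ν z.1).toReal : ℂ) + boundaryOp α β F n z := by
    intro n z
    have h0 : G n z = (openProb p q α β ν n z 0 : ℂ) + boundaryOp α β F n z := rfl
    rw [h0, openProb, tsum_eq_single z.1, transProb_zero, if_pos rfl, mul_one]
    intro y hy
    rw [transProb_zero, if_neg hy, mul_zero]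
  have hrow : ∀ y, (closedRate p q y).support.Finite := by
    rw [← openRate_zero_zero]
    exact finite_support_openRate p q 0 0
  refine lp.ext (funext fun n => lp.ext (funext fun x => ?_))
  have hL : LMat p q s hs G n x = ∑' z, laplace (closedProb p q n x z) s * G n z := rfl
  rw [hL]
  have hK := enorm_laplace_closedProb_le p q n hs x
  have hKtop := ENNReal.coe_ne_top (r := Real.toNNReal (1 / s.re))
  refine eq_tsum_of_forward_of_backward (e := fun z => s + exitRate (closedRate p q) z.1)
    (ρ := fun w z => ((closedRate p q w.1 z.1).toReal : ℂ)) (f := fun z => F n z)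
    (fun z => ?_) (fun z => ?_) ?_ ?_
  -- the forward equation at `s - α`, with the boundary terms moved to the source
  · have h := laplace_law_forward (tsum_openRate_ne_top p q α β)
      (finite_support_openRate p q α β) (finite_support_openRate_col p q α β) ν hsα z.1
    rw [tsum_openRate_mul p q α β z f, exitRate_openRate] at h
    change _ * f z.1 = _ at h
    simp only [hGz, boundaryOp_apply α β hF, hF]
    by_cases h0 : 0 ∈ z.1
    · simp only [h0, if_true, not_true, if_false] at h ⊢
      push_cast at h
      linear_combination h
    · simp only [h0, if_true, not_false_iff, if_false] at h ⊢
      push_cast at h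
      linear_combination h
  · have h := laplace_transProb_backward (tsum_closedRate_ne_top p q) hrow hs z.1 x.1
    rw [tsum_eq_tsum_config (n := n)] at h
    · simp only [Subtype.ext_iff]
      exact h
    · intro w hw
      rw [card_eq_of_closedRate_ne_zero (p := p) (q := q) (y := z.1) (x := w)
        fun h => hw (by simp [h]), z.2]
  · refine summable_of_tsum_enorm_ne_top (ne_top_of_le_ne_top
      (ENNReal.mul_ne_top hKtop (tsum_enorm_ne_top (G n))) ?_)
    rw [← ENNReal.tsum_mul_left]
    refine ENNReal.tsum_le_tsum fun z => ?_
    rw [enorm_mul]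
    exact mul_le_mul (hK z) le_rfl bot_le bot_le
  · refine summable_of_tsum_enorm_ne_top (ne_top_of_le_ne_top
      (ENNReal.mul_ne_top (ENNReal.mul_ne_top (ENNReal.natCast_ne_top n)
        (tsum_enorm_ne_top (F n))) hKtop) ?_)
    rw [ENNReal.tsum_prod', ← ENNReal.tsum_mul_left, ← ENNReal.tsum_mul_right]
    refine ENNReal.tsum_le_tsum fun w => ?_
    calc ∑' z : Config n,
          ‖((closedRate p q w.1 z.1).toReal : ℂ) * F n w * laplace (closedProb p q n x z) s‖ₑ
        ≤ ∑' z : Config n, closedRate p q w.1 z.1 * ‖F n w‖ₑ * (Real.toNNReal (1 / s.re) : ℝ≥0) := by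
          refine ENNReal.tsum_le_tsum fun z => ?_
          rw [enorm_mul, enorm_mul]
          exact mul_le_mul (mul_le_mul (enorm_toReal_le _) le_rfl bot_le bot_le) (hK z) bot_le bot_le
      _ ≤ n * ‖F n w‖ₑ * (Real.toNNReal (1 / s.re) : ℝ≥0) := by
          rw [ENNReal.tsum_mul_right, ENNReal.tsum_mul_right]
          refine mul_le_mul (mul_le_mul ?_ le_rfl bot_le bot_le) le_rfl bot_le bot_le
          refine (ENNReal.tsum_comp_le_tsum_of_injective Subtype.val_injective
            (fun z => closedRate p q w.1 z)).trans ((tsum_closedRate_le hpq w.1).trans_eq ?_)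
          rw [w.2]

end Perturbation

end ASEP
end

theorem theorem1 (p q α β : ℝ≥0) (hpq : p + q = 1) :
    ∃ s₀ : ℝ, ∀ (s : ℂ) (hs : 0 < s.re) (hsα : 0 < (s - ((α : ℝ) : ℂ)).re), s₀ < s.re →
      IsUnit (1 - ASEP.LMat p q s hs *
        ((((α : ℝ) : ℂ) - ((β : ℝ) : ℂ)) • ASEP.deltaMat + ((α : ℝ) : ℂ) • ASEP.AMat
          + ((β : ℝ) : ℂ) • ASEP.BMat)) ∧
      (∀ (n : ℕ) (x y : ASEP.Config n), MeasureTheory.IntegrableOn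
        (fun t : ℝ => Complex.exp (-s * t) * (ASEP.closedProb p q n x y t : ℂ)) (Set.Ioi 0)) ∧
      ∀ ν : PMF (Finset ℕ),
        (∀ (n : ℕ) (x : ASEP.Config n), MeasureTheory.IntegrableOn
          (fun t : ℝ => Complex.exp (-(s - ((α : ℝ) : ℂ)) * t) *
            (ASEP.openProb p q α β ν n x t : ℂ)) (Set.Ioi 0)) ∧
        ASEP.PHat p q α β ν (s - ((α : ℝ) : ℂ)) hsα =
          Ring.inverse (1 - ASEP.LMat p q s hs *
            ((((α : ℝ) : ℂ) - ((β : ℝ) : ℂ)) • ASEP.deltaMat + ((α : ℝ) : ℂ) • ASEP.AMat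
              + ((β : ℝ) : ℂ) • ASEP.BMat))
            (ASEP.LMat p q s hs (ASEP.PVec p q α β ν 0 le_rfl)) := by
  refine ⟨2 * (α + β), fun s hs hsα h₀ => ?_⟩
  change IsUnit (1 - ASEP.LMat p q s hs * ASEP.boundaryOp α β) ∧ _ ∧ ∀ ν, _ ∧ _ =
    Ring.inverse (1 - ASEP.LMat p q s hs * ASEP.boundaryOp α β) _
  have hU : IsUnit (1 - ASEP.LMat p q s hs * ASEP.boundaryOp α β) := by
    refine isUnit_one_sub_of_norm_lt_one ?_
    calc ‖ASEP.LMat p q s hs * ASEP.boundaryOp α β‖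
        ≤ 1 / s.re * (2 * (α + β)) := (norm_mul_le _ _).trans
          (mul_le_mul (ASEP.norm_LMat_le hs) (ASEP.norm_boundaryOp_le α β) (norm_nonneg _) (by positivity))
      _ < 1 := by rwa [one_div, inv_mul_lt_iff₀ hs, mul_one]
  refine ⟨hU, fun n x y => ?_, fun ν => ⟨fun n x => ?_, ?_⟩⟩
  · exact ASEP.integrableOn_exp_mul_toReal (ASEP.measurable_transProb _ _ _)
      (fun t ht => ASEP.transProb_le_one (ASEP.tsum_closedRate_ne_top p q) ht _ _) hs
  · exact ASEP.integrableOn_exp_mul_toReal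
      (Measurable.tsum fun y => (ASEP.measurable_transProb _ _ _).const_mul _)
      (fun t ht => ASEP.tsum_law_transProb_le_one (ASEP.tsum_openRate_ne_top p q α β) ν ht _) hsα
  · have h := ASEP.PHat_eq (β := β) hpq ν hs hsα
    set P := ASEP.PHat p q α β ν (s - ((α : ℝ) : ℂ)) hsα
    have hP : (1 - ASEP.LMat p q s hs * ASEP.boundaryOp α β) P =
        ASEP.LMat p q s hs (ASEP.PVec p q α β ν 0 le_rfl) := by
      rw [map_add] at h
      exact sub_eq_iff_eq_add.2 h
    rw [← hP, ← mul_apply_eq_comp, Ring.inverse_mul_cancel _ hU]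
    rfl
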